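/- The game Bodyguards and Presidents is played on a finite graph $G$. First each of $k$ bodyguard tokens is placed on a vertex, then the president token is placed on a vertex (several tokens may share a vertex). The players then alternate turns with full information, the bodyguards moving first; on a turn, each token of the player either stays where it is or moves to an adjacent vertex. The bodyguards win if, at the end of all but finitely many of their turns, every vertex of the open neighbourhood of the president's vertex is occupied by a bodyguard; otherwise the president wins. The bodyguard number $B(G)$ is the least $k$ for which $k$ bodyguards have a winning strategy on $G$. Let $P_n$ denote the path on $n$ vertices and $\square$ the Cartesian product of graphs. **Theorem.** If $2\le n\le m$, then $$B(P_n\square P_m)=\begin{cases}2&\text{if } n=m=2,\\ 3&\text{if } n=2 \text{ and } m\ge 3,\\ 4&\text{if } n=3\text{ and } m\ge 3,\\ 5&\text{if } n,m\ge 4.\end{cases}$$ -/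

import Mathlib

namespace BodyguardGame

variable {V : Type*}

/-- One move of a single token: it stays where it is or goes to an adjacent vertex. -/
def Step (G : SimpleGraph V) (u v : V) : Prop :=
  u = v ∨ G.Adj u v

/-- A legal sequence of positions of the president: he is placed on an arbitrary vertex `p 0`,
and his position after his `t`-th move is `p t`. -/
def IsPresidentPlay (G : SimpleGraph V) (p : ℕ → V) : Prop :=
  ∀ t, Step G (p t) (p (t + 1))

/-- The first `t` positions `p 0, …, p (t - 1)` of the president, in order. -/
def history (p : ℕ → V) (t : ℕ) : List V :=
  (List.range t).map p

/-- The president on `v` is surrounded by the tokens `b`: every vertex of the open neighbourhood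
of `v` is occupied (other tokens may be anywhere, several may share a vertex). -/
def Surrounded (G : SimpleGraph V) {k : ℕ} (b : Fin k → V) (v : V) : Prop :=
  ∀ u, G.Adj v u → ∃ i, b i = u

/-- `k` bodyguards can win on `G`. A strategy `σ` tells the bodyguards where to be, given the
positions of the president seen so far (their own earlier positions are determined by these).
`σ []` is the initial placement, made before the president is placed, and after the president's
positions `p 0, …, p t` the bodyguards move from `σ [p 0, …, p (t - 1)]` to `σ [p 0, …, p t]`.
Against every play of the president all moves have to be legal, and the president has to be
surrounded at the end of all but finitely many bodyguard turns. -/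
def BodyguardsWin (G : SimpleGraph V) (k : ℕ) : Prop :=
  ∃ σ : List V → Fin k → V, ∀ p : ℕ → V, IsPresidentPlay G p →
    (∀ t i, Step G (σ (history p t) i) (σ (history p (t + 1)) i)) ∧
    ∃ T, ∀ t, T ≤ t → Surrounded G (σ (history p (t + 1))) (p t)

/-- The bodyguard number of a finite graph: the least number of bodyguards that can win. -/
noncomputable def bodyguardNumber [Finite V] (G : SimpleGraph V) : ℕ :=
  sInf {k | BodyguardsWin G k}

end BodyguardGame

namespace BodyguardGame

/-! ### Shadow strategies and evasion on an arbitrary graph -/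

section Game

variable {V : Type*} {G : SimpleGraph V}

/-! Upper bounds come from shadows: images of the president's position under maps that send steps to
steps. A bodyguard standing on a shadow can follow it forever, so the bodyguards win once they hold
shadows that cover all neighbours (`bodyguardsWin_of_catchable`). The shadows are caught one after
another by the tokens still free. On a grid two free tokens always suffice, one aligning rows first
and the other columns first, since a step of the shadow cannot hinder both; a shadow confined to one
row needs a single token. Four truncated translations thus need 5 tokens, and on narrow grids
shadows confined to a row save tokens.

Most lower bounds are vertex degrees. For `4 ≤ n, m`, four tokens surrounding an interior vertex
occupy its neighbours bijectively. The president walks in the central 2 × 2 square: by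
`surrounded_of_step_surrounded`, if staying and both moves inside the square could all be answered
by surrounding him, he was surrounded already. So, once free, he stays free. -/

theorem Step.refl (v : V) : Step G v v := Or.inl rfl

theorem history_succ (p : ℕ → V) (t : ℕ) : history p (t + 1) = history p t ++ [p t] := by
  simp [history, List.range_succ]

/-- From the president's position `q` and the tokens `a`, the tokens can force the condition
`Goal` to hold after exactly `N` rounds, each round being a move of the president followed by one
of the tokens. -/
def ReachIn (G : SimpleGraph V) {c : ℕ} (Goal : V → (Fin c → V) → Prop) :
    ℕ → V → (Fin c → V) → Prop
  | 0, q, a => Goal q a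
  | N + 1, q, a => ∀ q', Step G q q' →
      ∃ a', (∀ i, Step G (a i) (a' i)) ∧ ReachIn G Goal N q' a'

theorem ReachIn.trans {c : ℕ} {Goal Goal' : V → (Fin c → V) → Prop} {N : ℕ}
    (h : ∀ q a, Goal q a → ReachIn G Goal' N q a) :
    ∀ (M : ℕ) (q : V) (a : Fin c → V), ReachIn G Goal M q a → ReachIn G Goal' (M + N) q a
  | 0, q, a, H => by simpa using h q a H
  | M + 1, q, a, H => by
    rw [Nat.succ_add]
    intro q' hq
    obtain ⟨a', ha, H'⟩ := H q' hq
    exact ⟨a', ha, ReachIn.trans h M q' a' H'⟩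

/-- A measure that the tokens can decrease in every round as long as it is positive. -/
theorem reachIn_of_measure {c : ℕ} {Goal : V → (Fin c → V) → Prop} (μ : V → (Fin c → V) → ℕ)
    (h0 : ∀ q a, μ q a = 0 → Goal q a)
    (hs : ∀ q a q', Step G q q' →
      ∃ a', (∀ i, Step G (a i) (a' i)) ∧ (μ q' a' < μ q a ∨ μ q' a' = 0)) :
    ∀ (N : ℕ) (q : V) (a : Fin c → V), μ q a ≤ N → ReachIn G Goal N q a
  | 0, q, a, h => h0 q a (by omega)
  | N + 1, q, a, h => by
    intro q' hq
    obtain ⟨a', ha, H⟩ := hs q a q' hq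
    exact ⟨a', ha, reachIn_of_measure μ h0 hs N q' a' (by omega)⟩

/-- A condition that can be forced from everywhere in a bounded number of rounds, that can be
maintained, and that implies that the president is surrounded, gives a winning strategy. -/
theorem bodyguardsWin_of_reachIn [Nonempty V] {k : ℕ} {Goal : V → (Fin k → V) → Prop} {N : ℕ}
    (hreach : ∀ q b, ReachIn G Goal N q b)
    (hkeep : ∀ q b, Goal q b → ∀ q', Step G q q' →
      ∃ b', (∀ i, Step G (b i) (b' i)) ∧ Goal q' b')
    (hgoal : ∀ q b, Goal q b → Surrounded G b q) : BodyguardsWin G k := by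
  classical
  obtain ⟨v₀⟩ := ‹Nonempty V›
  let upd : ℕ × (Fin k → V) → V → ℕ × (Fin k → V) := fun s q =>
    (s.1 - 1, if h : ∃ b', (∀ i, Step G (s.2 i) (b' i)) ∧ ReachIn G Goal (s.1 - 1) q b'
      then h.choose else s.2)
  have hupd : ∀ s q, (∃ b', (∀ i, Step G (s.2 i) (b' i)) ∧ ReachIn G Goal (s.1 - 1) q b') →
      (∀ i, Step G (s.2 i) ((upd s q).2 i)) ∧ ReachIn G Goal (s.1 - 1) q (upd s q).2 := by
    intro s q h
    simp only [upd, dif_pos h]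
    exact h.choose_spec
  -- The answer to the president's placement also lowers the counter, hence `N + 1`. The starting
  -- vertex is arbitrary because `hreach` holds from every position.
  let st : List V → ℕ × (Fin k → V) := fun l => l.foldl upd (N + 1, fun _ => v₀)
  have hst : ∀ (p : ℕ → V) t, st (history p (t + 1)) = upd (st (history p t)) (p t) := by
    intro p t
    simp [st, history_succ]
  refine ⟨fun l => (st l).2, fun p hp => ?_⟩
  have key : ∀ t, (∀ i, Step G ((st (history p t)).2 i) ((st (history p (t + 1))).2 i)) ∧
      (st (history p (t + 1))).1 = N - t ∧
      ReachIn G Goal (N - t) (p t) (st (history p (t + 1))).2 := by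
    intro t
    induction t with
    | zero =>
      have := hupd (st (history p 0)) (p 0) ⟨_, fun i => Step.refl _, hreach _ _⟩
      rw [hst]
      exact ⟨this.1, rfl, this.2⟩
    | succ t ih =>
      obtain ⟨-, h1, h2⟩ := ih
      have hN : N - (t + 1) = (st (history p (t + 1))).1 - 1 := by omega
      rw [hst p (t + 1), hN]
      refine (fun h => ⟨h.1, rfl, h.2⟩) (hupd (st (history p (t + 1))) (p (t + 1)) ?_)
      rw [h1]
      cases hd : N - t with
      | zero => rw [hd] at h2; exact hkeep _ _ h2 _ (hp t)
      | succ d => rw [hd] at h2; exact h2 _ (hp t)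
  refine ⟨fun t => (key t).1, N, fun t ht => hgoal _ _ ?_⟩
  have := (key t).2.2
  rwa [Nat.sub_eq_zero_of_le ht] at this

/-- Within a bounded number of rounds, one of `c` tokens can be brought to the image `f q` of the
president's position `q`. -/
def Catchable (G : SimpleGraph V) (f : V → V) (c : ℕ) : Prop :=
  ∃ N, ∀ q (a : Fin c → V), ReachIn G (fun q a => ∃ i, a i = f q) N q a

/-- Some arrangement of the tokens has the first `j` of them on the images of the president's
position under `F 0, …, F (j - 1)`. -/
def Tracks {k : ℕ} (F : ℕ → V → V) (j : ℕ) (q : V) (b : Fin k → V) : Prop :=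
  ∃ e : Equiv.Perm (Fin k), ∀ i : Fin k, i.val < j → b (e i) = F i q

/-- The tokens already on their images keep following them, because each `F i` preserves steps; the
other `k - j` tokens meanwhile play the catching strategy for `F j`. -/
theorem reachIn_tracks_succ {k j : ℕ} {F : ℕ → V → V} (hj : j < k)
    (hF : ∀ i < j, ∀ u v, Step G u v → Step G (F i u) (F i v)) (e : Equiv.Perm (Fin k)) :
    ∀ (N : ℕ) (q : V) (b : Fin k → V), (∀ i : Fin k, i.val < j → b (e i) = F i q) →
      ReachIn G (fun q a => ∃ i, a i = F j q) N q
        (fun x : Fin (k - j) => b (e ⟨j + x, by omega⟩)) →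
      ReachIn G (Tracks F (j + 1)) N q b
  | 0, q, b, hb, ⟨x, hx⟩ => by
    -- Whichever free token made the catch is renumbered as the `j`-th.
    refine ⟨(Equiv.swap ⟨j, hj⟩ ⟨j + x, by omega⟩).trans e, fun i hi => ?_⟩
    rcases Nat.lt_succ_iff_lt_or_eq.1 hi with hi | rfl
    · rw [Equiv.trans_apply, Equiv.swap_apply_of_ne_of_ne, hb i hi]
      · intro h; rw [h] at hi; simp at hi
      · intro h; rw [h] at hi; simp at hi
    · simpa using hx
  | N + 1, q, b, hb, H => by
    intro q' hq
    obtain ⟨a', ha, H'⟩ := H q' hq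
    have : ∀ i : Fin k, ∃ v, Step G (b (e i)) v ∧ (i.val < j → v = F i q') ∧
        ∀ x : Fin (k - j), i.val = j + x → v = a' x := by
      intro i
      by_cases hi : i.val < j
      · exact ⟨F i q', hb i hi ▸ hF i hi _ _ hq, fun _ => rfl, fun x hx => by omega⟩
      · refine ⟨a' ⟨i - j, by omega⟩, ?_, fun h => absurd h hi, fun x hx => ?_⟩
        · have := ha ⟨i - j, by omega⟩
          have h' : (⟨j + (i - j), by omega⟩ : Fin k) = i := Fin.ext (by simp; omega)
          simpa only [h'] using this
        · congr 1; apply Fin.ext; simp; omega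
    choose w hw using this
    refine ⟨fun g => w (e.symm g), fun g => by simpa using (hw (e.symm g)).1,
      reachIn_tracks_succ hj hF e N q' _ (fun i hi => by simpa using (hw i).2.1 hi) ?_⟩
    convert H' using 2 with x
    simpa using (hw ⟨j + x, by omega⟩).2.2 x rfl

/-- If the neighbours of every vertex are among its images under `k'` weak endomorphisms, the
`j`-th of which can be caught by `k - j` tokens, then `k` bodyguards can win. -/
theorem bodyguardsWin_of_catchable [Nonempty V] {k k' : ℕ} (hk : k' ≤ k) (F : ℕ → V → V)
    (hF : ∀ i < k', ∀ u v, Step G u v → Step G (F i u) (F i v))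
    (hc : ∀ i < k', Catchable G (F i) (k - i))
    (hN : ∀ v u, G.Adj v u → ∃ i < k', F i v = u) : BodyguardsWin G k := by
  have hreach : ∀ j ≤ k', ∃ N, ∀ q (b : Fin k → V), ReachIn G (Tracks F j) N q b := by
    intro j
    induction j with
    | zero => exact fun _ => ⟨0, fun q b => ⟨Equiv.refl _, fun i hi => by omega⟩⟩
    | succ j ih =>
      intro hj
      obtain ⟨M, hM⟩ := ih (by omega)
      obtain ⟨N, hN⟩ := hc j (by omega)
      refine ⟨M + N, fun q b => ReachIn.trans ?_ M q b (hM q b)⟩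
      rintro q b ⟨e, he⟩
      exact reachIn_tracks_succ (by omega) (fun i hi => hF i (by omega)) e N q b he (hN _ _)
  obtain ⟨N, hN'⟩ := hreach k' le_rfl
  refine bodyguardsWin_of_reachIn hN' ?_ ?_
  · rintro q b ⟨e, he⟩ q' hq
    refine ⟨fun g => if (e.symm g).val < k' then F (e.symm g) q' else b g, fun g => ?_,
      e, fun i hi => by simp [hi]⟩
    dsimp only
    split_ifs with h
    · have := he _ h
      rw [Equiv.apply_symm_apply] at this
      rw [this]
      exact hF _ h _ _ hq
    · exact Step.refl _
  · rintro q b ⟨e, he⟩ u hu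
    obtain ⟨i, hi, rfl⟩ := hN q u hu
    exact ⟨e ⟨i, by omega⟩, he ⟨i, by omega⟩ hi⟩

/-- Consider a president who never leaves `v`. -/
theorem card_le_of_bodyguardsWin {k : ℕ} (h : BodyguardsWin G k) (v : V) (S : Finset V)
    (hS : ∀ u ∈ S, G.Adj v u) : S.card ≤ k := by
  classical
  obtain ⟨σ, hσ⟩ := h
  obtain ⟨-, T, hT⟩ := hσ (fun _ => v) (fun _ => Step.refl v)
  have : S ⊆ Finset.univ.image (σ (history (fun _ => v) (T + 1))) := fun u hu => by
    simpa using hT T le_rfl u (hS u hu)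
  simpa using (Finset.card_le_card this).trans Finset.card_image_le

/-- If `k` tokens surround a vertex with at least `k` neighbours, then they are on distinct
neighbours. -/
theorem Surrounded.injective_and_adj {k : ℕ} {b : Fin k → V} {v : V} (h : Surrounded G b v)
    (S : Finset V) (hS : ∀ u ∈ S, G.Adj v u) (hk : k ≤ S.card) :
    Function.Injective b ∧ ∀ i, G.Adj v (b i) := by
  classical
  have hsub : S ⊆ Finset.univ.image b := fun u hu => by simpa using h u (hS u hu)
  have hle : (Finset.univ.image b).card ≤ k :=
    Finset.card_image_le.trans_eq (by simp)
  have heq : S = Finset.univ.image b := Finset.eq_of_subset_of_card_le hsub (by omega)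
  refine ⟨?_, fun i => hS _ (heq ▸ Finset.mem_image_of_mem b (Finset.mem_univ i))⟩
  have : (Finset.univ.image b).card = (Finset.univ : Finset (Fin k)).card := by
    rw [← heq]; simp; have := congrArg Finset.card heq; omega
  simpa using Finset.card_image_iff.1 this

/-- The president evades if he can always move so that the tokens cannot reach a position that
is unsafe for him. -/
theorem not_bodyguardsWin_of_safe {k : ℕ} (Safe : V → (Fin k → V) → Prop)
    (hstart : ∀ b : Fin k → V, ∃ v, ∀ b', (∀ i, Step G (b i) (b' i)) → Safe v b')
    (hstep : ∀ v b, Safe v b →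
      ∃ v', Step G v v' ∧ ∀ b', (∀ i, Step G (b i) (b' i)) → Safe v' b')
    (hsafe : ∀ v b, Safe v b → ¬ Surrounded G b v) : ¬ BodyguardsWin G k := by
  classical
  rintro ⟨σ, hσ⟩
  obtain ⟨v₀, hv₀⟩ := hstart (σ [])
  let next : V → (Fin k → V) → V := fun v b =>
    if h : ∃ v', Step G v v' ∧ ∀ b', (∀ i, Step G (b i) (b' i)) → Safe v' b' then h.choose else v
  have hnext : ∀ v b, Step G v (next v b) := by
    intro v b
    by_cases h : ∃ v', Step G v v' ∧ ∀ b', (∀ i, Step G (b i) (b' i)) → Safe v' b'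
    · simp only [next, dif_pos h]; exact h.choose_spec.1
    · simp only [next, dif_neg h]; exact Step.refl v
  have hnext' : ∀ v b, Safe v b → ∀ b', (∀ i, Step G (b i) (b' i)) → Safe (next v b) b' := by
    intro v b hs
    have h := hstep v b hs
    simp only [next, dif_pos h]
    exact h.choose_spec.2
  let s : ℕ → List V × V := fun t => Nat.rec ([], v₀)
    (fun _ s => (s.1 ++ [s.2], next s.2 (σ (s.1 ++ [s.2])))) t
  let p : ℕ → V := fun t => (s t).2
  have hhist : ∀ t, history p t = (s t).1 := by
    intro t
    induction t with
    | zero => rfl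
    | succ t ih => rw [history_succ, ih]
  have hp : ∀ t, p (t + 1) = next (p t) (σ (history p (t + 1))) := by
    intro t
    rw [hhist]
  obtain ⟨hmove, T, hT⟩ := hσ p (fun t => by rw [hp]; exact hnext _ _)
  have hall : ∀ t, Safe (p t) (σ (history p (t + 1))) := by
    intro t
    induction t with
    | zero => exact hv₀ _ (hmove 0)
    | succ t ih => rw [hp]; exact hnext' _ _ ih _ (hmove (t + 1))
  exact hsafe _ _ (hall T) (hT T le_rfl)

end Game

/-! ### Chasing a shadow on a grid -/

section Grid

open SimpleGraph

variable {n m : ℕ}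

theorem grid_adj_iff (u v : Fin n × Fin m) : (pathGraph n □ pathGraph m).Adj u v ↔
    ((u.1.val + 1 = v.1.val ∨ v.1.val + 1 = u.1.val) ∧ u.2.val = v.2.val) ∨
    ((u.2.val + 1 = v.2.val ∨ v.2.val + 1 = u.2.val) ∧ u.1.val = v.1.val) := by
  simp [boxProd_adj, pathGraph_adj, Fin.ext_iff]

theorem grid_step_iff (u v : Fin n × Fin m) : Step (pathGraph n □ pathGraph m) u v ↔
    (u.1.val = v.1.val ∧ u.2.val = v.2.val) ∨
    ((u.1.val + 1 = v.1.val ∨ v.1.val + 1 = u.1.val) ∧ u.2.val = v.2.val) ∨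
    ((u.2.val + 1 = v.2.val ∨ v.2.val + 1 = u.2.val) ∧ u.1.val = v.1.val) := by
  rw [Step, grid_adj_iff, Prod.ext_iff, Fin.ext_iff, Fin.ext_iff]

/-- One move on a path from `x` towards `y`. -/
def toward (x y : Fin n) : Fin n :=
  if h : x.val < y.val then ⟨x + 1, by omega⟩
  else if y.val < x.val then ⟨x - 1, by omega⟩ else x

theorem toward_val (x y : Fin n) : (toward x y).val =
    if x.val < y.val then x.val + 1 else if y.val < x.val then x.val - 1 else x.val := by
  unfold toward
  split_ifs <;> rfl

/-- How far a token on `x` can still go on a path in its current direction, towards `y`. -/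
def room (x y : Fin n) : ℕ :=
  if x.val < y.val then n - x else if y.val < x.val then x else 0

theorem room_eq_zero {x y : Fin n} (h : room x y = 0) : x = y := by
  unfold room at h
  apply Fin.ext
  split_ifs at h <;> omega

theorem room_le (x y : Fin n) : room x y ≤ n := by
  unfold room
  split_ifs <;> omega

/-- The distance to a fleeing target need not shrink, but the distance to the wall behind it does. A
target that turns back is met, never passed. -/
theorem room_toward {x y y' : Fin n}
    (h : y.val = y'.val ∨ y.val + 1 = y'.val ∨ y'.val + 1 = y.val) :
    room (toward x y') y' < room x y ∨ room (toward x y') y' = 0 := by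
  simp only [room, toward_val]
  split_ifs <;> omega

/-- The move of a token on `a` that chases a target on `r`, first in the first coordinate. -/
def chaseFst (a r : Fin n × Fin m) : Fin n × Fin m :=
  if a.1 = r.1 then (a.1, toward a.2 r.2) else (toward a.1 r.1, a.2)

/-- The measure that decreases when a token on `a` chases a target on `r`. -/
def measureFst (a r : Fin n × Fin m) : ℕ := room a.1 r.1 * (m + 1) + room a.2 r.2

theorem step_chaseFst (a r : Fin n × Fin m) :
    Step (pathGraph n □ pathGraph m) a (chaseFst a r) := by
  rw [grid_step_iff]
  have h1 := toward_val a.1 r.1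
  have h2 := toward_val a.2 r.2
  unfold chaseFst
  split_ifs at h1 h2 ⊢ <;> dsimp only <;> omega

theorem measureFst_eq_zero {a r : Fin n × Fin m} (h : measureFst a r = 0) : a = r := by
  simp only [measureFst, Nat.add_eq_zero_iff, Nat.mul_eq_zero] at h
  exact Prod.ext (room_eq_zero (by omega)) (room_eq_zero h.2)

theorem measureFst_le (a r : Fin n × Fin m) : measureFst a r ≤ n * (m + 1) + m :=
  Nat.add_le_add (Nat.mul_le_mul_right _ (room_le _ _)) (room_le _ _)

theorem room_self (x : Fin n) : room x x = 0 := by simp [room]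

/-- The weight `m + 1` makes the measure lexicographic. Progress stalls only if the token is aligned
in the first coordinate and must spend its move to stay aligned. -/
theorem measureFst_chaseFst {a r r' : Fin n × Fin m}
    (h : Step (pathGraph n □ pathGraph m) r r') :
    measureFst (chaseFst a r') r' < measureFst a r ∨ measureFst (chaseFst a r') r' = 0 ∨
      (measureFst (chaseFst a r') r' = measureFst a r ∧ r.1 ≠ r'.1) := by
  rw [grid_step_iff] at h
  by_cases har : a.1 = r.1
  · by_cases hr : r.1 = r'.1
    · have ha' : a.1 = r'.1 := har.trans hr
      have := room_toward (x := a.2) (y := r.2) (y' := r'.2) (by omega)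
      simp only [measureFst, chaseFst, if_pos ha']
      rw [← ha', ← har]
      simp only [room_self]
      omega
    · have hr2 : r'.2 = r.2 := Fin.ext (by rw [Fin.ext_iff] at hr; omega)
      have := room_toward (x := a.1) (y := r.1) (y' := r'.1) (by omega)
      have h0 : room a.1 r.1 = 0 := by rw [har, room_self]
      have h0' : room (toward a.1 r'.1) r'.1 = 0 := by omega
      refine Or.inr (Or.inr ⟨?_, hr⟩)
      simp only [measureFst, chaseFst, if_neg (fun h => hr (har.symm.trans h) : a.1 ≠ r'.1)]
      rw [h0', h0, hr2]
  · have hpos : room a.1 r.1 ≠ 0 := fun h0 => har (room_eq_zero h0)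
    left
    have key : measureFst (chaseFst a r') r' ≤ (room a.1 r.1 - 1) * (m + 1) + m := by
      refine Nat.add_le_add (Nat.mul_le_mul_right _ ?_) (room_le _ _)
      have := room_toward (x := a.1) (y := r.1) (y' := r'.1) (by omega)
      unfold chaseFst
      split_ifs with h1
      · simp [h1, room_self]
      · dsimp only; omega
    obtain ⟨d, hd⟩ := Nat.exists_eq_succ_of_ne_zero hpos
    refine key.trans_lt ?_
    rw [measureFst, hd, Nat.succ_mul, Nat.succ_sub_one]
    omega

theorem grid_step_swap {u v : Fin n × Fin m} (h : Step (pathGraph n □ pathGraph m) u v) :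
    Step (pathGraph m □ pathGraph n) u.swap v.swap := by
  rw [grid_step_iff] at h ⊢
  simp only [Prod.fst_swap, Prod.snd_swap]
  omega

/-- One token catches a shadow of the president that stays in one row. -/
theorem catchable_of_fst_eq {f : Fin n × Fin m → Fin n × Fin m} {c : ℕ} (hc : 1 ≤ c)
    (hf : ∀ u v, Step (pathGraph n □ pathGraph m) u v →
      Step (pathGraph n □ pathGraph m) (f u) (f v))
    (hrow : ∀ u v, (f u).1 = (f v).1) : Catchable (pathGraph n □ pathGraph m) f c := by
  let i₀ : Fin c := ⟨0, hc⟩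
  refine ⟨n * (m + 1) + m, fun q a => reachIn_of_measure (fun q a => measureFst (a i₀) (f q))
    (fun q a h => ⟨i₀, measureFst_eq_zero h⟩) (fun q a q' hq => ?_) _ q a (measureFst_le _ _)⟩
  refine ⟨fun i => if i = i₀ then chaseFst (a i) (f q') else a i, fun i => ?_, ?_⟩
  · dsimp only
    split_ifs
    · exact step_chaseFst _ _
    · exact Step.refl _
  · rcases measureFst_chaseFst (a := a i₀) (hf _ _ hq) with h | h | h
    · exact Or.inl (by simpa using h)
    · exact Or.inr (by simpa using h)
    · exact absurd (hrow q q') h.2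

/-- Two tokens catch every shadow of the president. -/
theorem catchable_of_two_le {f : Fin n × Fin m → Fin n × Fin m} {c : ℕ} (hc : 2 ≤ c)
    (hf : ∀ u v, Step (pathGraph n □ pathGraph m) u v →
      Step (pathGraph n □ pathGraph m) (f u) (f v)) :
    Catchable (pathGraph n □ pathGraph m) f c := by
  let i₀ : Fin c := ⟨0, by omega⟩
  let i₁ : Fin c := ⟨1, by omega⟩
  have hne : i₁ ≠ i₀ := fun h => by simp [i₀, i₁] at h
  -- Either catch suffices, so the sum is replaced by 0 as soon as one summand vanishes.
  let μ : Fin n × Fin m → (Fin c → Fin n × Fin m) → ℕ := fun q a =>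
    if measureFst (a i₀) (f q) = 0 ∨ measureFst (a i₁).swap (f q).swap = 0 then 0
    else measureFst (a i₀) (f q) + measureFst (a i₁).swap (f q).swap
  refine ⟨(n * (m + 1) + m) + (m * (n + 1) + n), fun q a => reachIn_of_measure μ
    (fun q a h => ?_) (fun q a q' hq => ?_) _ q a ?_⟩
  · dsimp only [μ] at h
    split_ifs at h with h0
    · rcases h0 with h0 | h0
      · exact ⟨i₀, measureFst_eq_zero h0⟩
      · exact ⟨i₁, Prod.swap_injective (measureFst_eq_zero h0)⟩
    · omega
  · refine ⟨fun i => if i = i₀ then chaseFst (a i) (f q') else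
      if i = i₁ then (chaseFst (a i).swap (f q').swap).swap else a i, fun i => ?_, ?_⟩
    · dsimp only
      split_ifs
      · exact step_chaseFst _ _
      · exact grid_step_swap (step_chaseFst (a i).swap (f q').swap)
      · exact Step.refl _
    · have hs := hf _ _ hq
      have h0 := measureFst_chaseFst (a := a i₀) hs
      have h1 := measureFst_chaseFst (a := (a i₁).swap) (grid_step_swap hs)
      -- A step changes at most one coordinate, so the two chases cannot stall together.
      have h2 : (f q).1 = (f q').1 ∨ (f q).2 = (f q').2 := by
        rw [grid_step_iff] at hs
        rw [Fin.ext_iff, Fin.ext_iff]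
        omega
      simp only [μ, if_true, if_neg hne, Prod.swap_swap, Prod.fst_swap] at h0 h1 ⊢
      split_ifs <;> grind
  · dsimp only [μ]
    split_ifs
    · omega
    · exact Nat.add_le_add (measureFst_le _ _) (measureFst_le _ _)

/-! ### Evading four bodyguards -/

/-- An interior vertex of a grid has four neighbours. -/
theorem exists_four_neighbors (v : Fin n × Fin m) (h1 : 0 < v.1.val) (h2 : v.1.val + 1 < n)
    (h3 : 0 < v.2.val) (h4 : v.2.val + 1 < m) :
    ∃ S : Finset (Fin n × Fin m), S.card = 4 ∧ ∀ u ∈ S, (pathGraph n □ pathGraph m).Adj v u := by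
  refine ⟨{(⟨v.1 - 1, by omega⟩, v.2), (⟨v.1 + 1, by omega⟩, v.2),
    (v.1, ⟨v.2 - 1, by omega⟩), (v.1, ⟨v.2 + 1, by omega⟩)}, ?_, ?_⟩
  · rw [Finset.card_insert_of_notMem, Finset.card_insert_of_notMem, Finset.card_pair] <;>
      simp only [Finset.mem_insert, Finset.mem_singleton, Prod.ext_iff, Fin.ext_iff, ne_eq] <;>
      omega
  · intro u hu
    simp only [Finset.mem_insert, Finset.mem_singleton] at hu
    rw [grid_adj_iff]
    rcases hu with rfl | rfl | rfl | rfl <;> dsimp only <;> omega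

/-- The grid is bipartite and `x`, `y` have opposite colours; `g` shares its colour with one of
them, and a step within a colour class is no move. -/
theorem eq_or_eq_of_step {v w x y g : Fin n × Fin m}
    (hvw : (pathGraph n □ pathGraph m).Adj v w)
    (hx : (pathGraph n □ pathGraph m).Adj v x) (hy : (pathGraph n □ pathGraph m).Adj w y)
    (hgx : Step (pathGraph n □ pathGraph m) g x) (hgy : Step (pathGraph n □ pathGraph m) g y) :
    g = x ∨ g = y := by
  simp only [grid_adj_iff, grid_step_iff, Prod.ext_iff, Fin.ext_iff] at *
  omega

/-- If the four tokens `b` could surround each of `v`, its neighbour `w₁` in the first coordinate and its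
neighbour `w₂` in the second coordinate in one move, then they already surround `v`. -/
theorem surrounded_of_step_surrounded {v w₁ w₂ : Fin n × Fin m} {b b₀ b₁ b₂ : Fin 4 → Fin n × Fin m}
    (hv : 0 < v.1.val ∧ v.1.val + 1 < n ∧ 0 < v.2.val ∧ v.2.val + 1 < m)
    (h₁ : (v.1.val + 1 = w₁.1.val ∧ w₁.1.val + 1 < n ∨ w₁.1.val + 1 = v.1.val ∧ 0 < w₁.1.val) ∧
      w₁.2 = v.2)
    (h₂ : (v.2.val + 1 = w₂.2.val ∧ w₂.2.val + 1 < m ∨ w₂.2.val + 1 = v.2.val ∧ 0 < w₂.2.val) ∧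
      w₂.1 = v.1)
    (hb₀ : ∀ i, Step (pathGraph n □ pathGraph m) (b i) (b₀ i))
    (hs₀ : Surrounded (pathGraph n □ pathGraph m) b₀ v)
    (hb₁ : ∀ i, Step (pathGraph n □ pathGraph m) (b i) (b₁ i))
    (hs₁ : Surrounded (pathGraph n □ pathGraph m) b₁ w₁)
    (hb₂ : ∀ i, Step (pathGraph n □ pathGraph m) (b i) (b₂ i))
    (hs₂ : Surrounded (pathGraph n □ pathGraph m) b₂ w₂) :
    Surrounded (pathGraph n □ pathGraph m) b v := by
  rw [Fin.ext_iff] at h₁ h₂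
  have inj : ∀ w : Fin n × Fin m, (0 < w.1.val ∧ w.1.val + 1 < n ∧ 0 < w.2.val ∧ w.2.val + 1 < m) →
      ∀ c : Fin 4 → Fin n × Fin m, Surrounded (pathGraph n □ pathGraph m) c w →
      Function.Injective c ∧ ∀ i, (pathGraph n □ pathGraph m).Adj w (c i) := by
    intro w hw c hc
    obtain ⟨S, hS, hadj⟩ := exists_four_neighbors w hw.1 hw.2.1 hw.2.2.1 hw.2.2.2
    exact hc.injective_and_adj S hadj hS.ge
  obtain ⟨inj₀, adj₀⟩ := inj v hv b₀ hs₀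
  obtain ⟨-, adj₁⟩ := inj w₁ (by omega) b₁ hs₁
  obtain ⟨-, adj₂⟩ := inj w₂ (by omega) b₂ hs₂
  have hvw₁ : (pathGraph n □ pathGraph m).Adj v w₁ := by rw [grid_adj_iff]; omega
  have hvw₂ : (pathGraph n □ pathGraph m).Adj v w₂ := by rw [grid_adj_iff]; omega
  have par₁ := fun i => eq_or_eq_of_step hvw₁ (adj₀ i) (adj₁ i) (hb₀ i) (hb₁ i)
  have par₂ := fun i => eq_or_eq_of_step hvw₂ (adj₀ i) (adj₂ i) (hb₀ i) (hb₂ i)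
  /- A token that answers a move to `w₁` by going to a vertex `t` far from `w₂` is on a neighbour
  of `v`, and the same with `w₁` and `w₂` exchanged. -/
  have far₁ : ∀ t, (pathGraph n □ pathGraph m).Adj w₁ t →
      (∀ x, (pathGraph n □ pathGraph m).Adj w₂ x → ¬ Step (pathGraph n □ pathGraph m) x t) →
      ∃ i, b i = b₀ i ∧ b₁ i = t := by
    intro t ht hfar
    obtain ⟨i, hi⟩ := hs₁ t ht
    refine ⟨i, (par₂ i).resolve_right fun h => hfar _ (adj₂ i) ?_, hi⟩
    rw [← h, ← hi]
    exact hb₁ i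
  have far₂ : ∀ t, (pathGraph n □ pathGraph m).Adj w₂ t →
      (∀ x, (pathGraph n □ pathGraph m).Adj w₁ x → ¬ Step (pathGraph n □ pathGraph m) x t) →
      ∃ i, b i = b₀ i ∧ b₂ i = t := by
    intro t ht hfar
    obtain ⟨i, hi⟩ := hs₂ t ht
    refine ⟨i, (par₁ i).resolve_right fun h => hfar _ (adj₁ i) ?_, hi⟩
    rw [← h, ← hi]
    exact hb₂ i
  simp only [grid_adj_iff, grid_step_iff] at far₁ far₂ hb₁ hb₂ adj₀
  -- The target lies just beyond `w₁` as seen from `v`; among the neighbours of `v` only `w₁` is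
  -- within a step of it.
  obtain ⟨i₁, hi₁, ht₁⟩ := far₁ (⟨2 * w₁.1 - v.1, by omega⟩, v.2)
    (by dsimp only; omega) (by intro x hx; dsimp only; omega)
  obtain ⟨i₂, hi₂, ht₂⟩ := far₂ (v.1, ⟨2 * w₂.2 - v.2, by omega⟩)
    (by dsimp only; omega) (by intro x hx; dsimp only; omega)
  -- This target is diagonal to `v`, on the side away from `w₂`. It can be reached from `w₁` or from
  -- the neighbour of `v` opposite `w₂`, and `w₁` is already taken by token `i₁`.
  obtain ⟨j₁, hj₁, hu₁⟩ := far₁ (w₁.1, ⟨2 * v.2 - w₂.2, by omega⟩)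
    (by dsimp only; omega) (by intro x hx; dsimp only; omega)
  obtain ⟨j₂, hj₂, hu₂⟩ := far₂ (⟨2 * v.1 - w₁.1, by omega⟩, w₂.2)
    (by dsimp only; omega) (by intro x hx; dsimp only; omega)
  have hij₁ : b j₁ ≠ b i₁ := by
    rw [hi₁, hj₁]
    refine fun h => ?_
    rw [inj₀ h, ht₁, Prod.ext_iff, Fin.ext_iff, Fin.ext_iff] at hu₁
    dsimp only at hu₁
    omega
  have hij₂ : b j₂ ≠ b i₂ := by
    rw [hi₂, hj₂]
    refine fun h => ?_
    rw [inj₀ h, ht₂, Prod.ext_iff, Fin.ext_iff, Fin.ext_iff] at hu₂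
    dsimp only at hu₂
    omega
  rw [ne_eq, Prod.ext_iff, Fin.ext_iff, Fin.ext_iff] at hij₁ hij₂
  have ei₁ : (b i₁).1.val = w₁.1 ∧ (b i₁).2.val = v.2 := by
    have ha := adj₀ i₁
    have hs := hb₁ i₁
    rw [← hi₁] at ha
    rw [ht₁] at hs
    dsimp only at hs
    clear hij₁ hij₂
    omega
  have ei₂ : (b i₂).1.val = v.1 ∧ (b i₂).2.val = w₂.2 := by
    have ha := adj₀ i₂
    have hs := hb₂ i₂
    rw [← hi₂] at ha
    rw [ht₂] at hs
    dsimp only at hs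
    clear hij₁ hij₂
    omega
  have ej₁ : (b j₁).1.val = v.1 ∧ (b j₁).2.val + w₂.2 = 2 * v.2 := by
    have ha := adj₀ j₁
    have hs := hb₁ j₁
    rw [← hj₁] at ha
    rw [hu₁] at hs
    dsimp only at hs
    clear hij₂
    omega
  have ej₂ : (b j₂).1.val + w₁.1 = 2 * v.1 ∧ (b j₂).2.val = v.2 := by
    have ha := adj₀ j₂
    have hs := hb₂ j₂
    rw [← hj₂] at ha
    rw [hu₂] at hs
    dsimp only at hs
    clear hij₁
    omega
  clear hij₁ hij₂
  intro u hu
  rw [grid_adj_iff] at hu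
  have : (u.1.val = w₁.1 ∧ u.2.val = v.2) ∨ (u.1.val = v.1 ∧ u.2.val = w₂.2) ∨
      (u.1.val = v.1 ∧ u.2.val + w₂.2 = 2 * v.2) ∨
      (u.1.val + w₁.1 = 2 * v.1 ∧ u.2.val = v.2) := by omega
  rcases this with h | h | h | h
  · exact ⟨i₁, Prod.ext (Fin.ext (by omega)) (Fin.ext (by omega))⟩
  · exact ⟨i₂, Prod.ext (Fin.ext (by omega)) (Fin.ext (by omega))⟩
  · exact ⟨j₁, Prod.ext (Fin.ext (by omega)) (Fin.ext (by omega))⟩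
  · exact ⟨j₂, Prod.ext (Fin.ext (by omega)) (Fin.ext (by omega))⟩

theorem not_bodyguardsWin_four (hn : 4 ≤ n) (hm : 4 ≤ m) :
    ¬ BodyguardsWin (pathGraph n □ pathGraph m) 4 := by
  have hstep : ∀ (v : Fin n × Fin m) (b : Fin 4 → Fin n × Fin m),
      ((v.1.val = 1 ∨ v.1.val = 2) ∧ (v.2.val = 1 ∨ v.2.val = 2) ∧
        ¬ Surrounded (pathGraph n □ pathGraph m) b v) →
      ∃ v', Step (pathGraph n □ pathGraph m) v v' ∧
        ∀ b', (∀ i, Step (pathGraph n □ pathGraph m) (b i) (b' i)) →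
          ((v'.1.val = 1 ∨ v'.1.val = 2) ∧ (v'.2.val = 1 ∨ v'.2.val = 2) ∧
            ¬ Surrounded (pathGraph n □ pathGraph m) b' v') := by
    rintro v b ⟨hv1, hv2, hs⟩
    by_contra! H
    obtain ⟨b₀, hb₀, hs₀⟩ := H v (Step.refl v)
    -- `3 - x` exchanges 1 and 2, so the move stays inside the central square.
    obtain ⟨b₁, hb₁, hs₁⟩ := H (⟨3 - v.1, by omega⟩, v.2)
      (by rw [grid_step_iff]; dsimp only; omega)
    obtain ⟨b₂, hb₂, hs₂⟩ := H (v.1, ⟨3 - v.2, by omega⟩)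
      (by rw [grid_step_iff]; dsimp only; omega)
    exact hs (surrounded_of_step_surrounded (w₁ := (⟨3 - v.1, by omega⟩, v.2))
      (w₂ := (v.1, ⟨3 - v.2, by omega⟩)) (by omega) ⟨by dsimp only; omega, rfl⟩
      ⟨by dsimp only; omega, rfl⟩ hb₀ (hs₀ hv1 hv2) hb₁ (hs₁ (by dsimp only; omega) hv2)
      hb₂ (hs₂ hv1 (by dsimp only; omega)))
  refine not_bodyguardsWin_of_safe _ (fun b => ?_) hstep fun v b h => h.2.2
  -- The president starts as if moving from an unsurrounded vertex of the square. If (1, 1) is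
  -- surrounded, all tokens are next to it, so (1, 3) is empty and (1, 2) is not surrounded.
  by_cases hs : Surrounded (pathGraph n □ pathGraph m) b (⟨1, by omega⟩, ⟨1, by omega⟩)
  · obtain ⟨S, hS, hadj⟩ := exists_four_neighbors (n := n) (m := m)
      (⟨1, by omega⟩, ⟨1, by omega⟩) (by simp) (by dsimp only; omega) (by simp)
      (by dsimp only; omega)
    have hadj' := (hs.injective_and_adj S hadj hS.ge).2
    obtain ⟨v', -, h⟩ := hstep (⟨1, by omega⟩, ⟨2, by omega⟩) b ⟨by simp, by simp, fun h => by
      obtain ⟨i, hi⟩ := h (⟨1, by omega⟩, ⟨3, by omega⟩) (by rw [grid_adj_iff]; simp)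
      have := hadj' i
      rw [hi, grid_adj_iff] at this
      simp at this⟩
    exact ⟨v', h⟩
  · obtain ⟨v', -, h⟩ := hstep (⟨1, by omega⟩, ⟨1, by omega⟩) b ⟨by simp, by simp, hs⟩
    exact ⟨v', h⟩

/-! ### Shadow families for the upper bounds -/

theorem bodyguardsWin_five (hn : 1 ≤ n) (hm : 1 ≤ m) :
    BodyguardsWin (pathGraph n □ pathGraph m) 5 := by
  have : Nonempty (Fin n × Fin m) := ⟨(⟨0, hn⟩, ⟨0, hm⟩)⟩
  let F : ℕ → Fin n × Fin m → Fin n × Fin m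
    | 0, v => (⟨v.1 - 1, by omega⟩, v.2)
    | 1, v => (⟨min (v.1 + 1) (n - 1), by omega⟩, v.2)
    | 2, v => (v.1, ⟨v.2 - 1, by omega⟩)
    | _, v => (v.1, ⟨min (v.2 + 1) (m - 1), by omega⟩)
  have hF : ∀ i < 4, ∀ u v, Step (pathGraph n □ pathGraph m) u v →
      Step (pathGraph n □ pathGraph m) (F i u) (F i v) := by
    intro i hi u v h
    rw [grid_step_iff] at h ⊢
    interval_cases i <;> simp only [F] <;> omega
  refine bodyguardsWin_of_catchable (k' := 4) (by norm_num) F hF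
    (fun i hi => catchable_of_two_le (by omega) (hF i hi)) fun v u h => ?_
  rw [grid_adj_iff] at h
  have : (u.1.val + 1 = v.1.val ∧ u.2.val = v.2.val) ∨ (v.1.val + 1 = u.1.val ∧ u.2.val = v.2.val) ∨
    (u.2.val + 1 = v.2.val ∧ u.1.val = v.1.val) ∨ (v.2.val + 1 = u.2.val ∧ u.1.val = v.1.val) := by
    omega
  simp only [Prod.ext_iff, Fin.ext_iff]
  rcases this with h | h | h | h
  · exact ⟨0, by norm_num, by simp only [F]; omega⟩
  · exact ⟨1, by norm_num, by simp only [F]; omega⟩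
  · exact ⟨2, by norm_num, by simp only [F]; omega⟩
  · exact ⟨3, by norm_num, by simp only [F]; omega⟩

theorem bodyguardsWin_three_rows (hm : 1 ≤ m) :
    BodyguardsWin (pathGraph 3 □ pathGraph m) 4 := by
  have : Nonempty (Fin 3 × Fin m) := ⟨(0, ⟨0, hm⟩)⟩
  -- The vertical neighbours are covered by a fold exchanging row 1 with the outer rows and by the
  -- projection to row 2, which one token can catch last.
  let F : ℕ → Fin 3 × Fin m → Fin 3 × Fin m
    | 0, v => (v.1, ⟨v.2 - 1, by omega⟩)
    | 1, v => (v.1, ⟨min (v.2 + 1) (m - 1), by omega⟩)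
    | 2, v => (⟨(v.1 + 1) % 2, by omega⟩, v.2)
    | _, v => (2, v.2)
  have hF : ∀ i < 4, ∀ u v, Step (pathGraph 3 □ pathGraph m) u v →
      Step (pathGraph 3 □ pathGraph m) (F i u) (F i v) := by
    intro i hi u v h
    rw [grid_step_iff] at h ⊢
    interval_cases i <;> simp only [F, true_and, and_true] <;> omega
  refine bodyguardsWin_of_catchable (k' := 4) le_rfl F hF (fun i hi => ?_) fun v u h => ?_
  · by_cases h3 : i = 3
    · subst h3
      exact catchable_of_fst_eq le_rfl (hF 3 hi) fun _ _ => rfl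
    · exact catchable_of_two_le (by omega) (hF i hi)
  · rw [grid_adj_iff] at h
    have : (u.2.val + 1 = v.2.val ∧ u.1.val = v.1.val) ∨
        (v.2.val + 1 = u.2.val ∧ u.1.val = v.1.val) ∨
        (u.1.val = (v.1.val + 1) % 2 ∧ u.2.val = v.2.val) ∨ (u.1.val = 2 ∧ u.2.val = v.2.val) := by
      omega
    simp only [Prod.ext_iff, Fin.ext_iff]
    rcases this with h | h | h | h
    · exact ⟨0, by norm_num, by simp only [F]; omega⟩
    · exact ⟨1, by norm_num, by simp only [F]; omega⟩
    · exact ⟨2, by norm_num, by simp only [F]; omega⟩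
    · exact ⟨3, by norm_num, h.1.symm, h.2.symm⟩

theorem bodyguardsWin_two_rows (hm : 1 ≤ m) :
    BodyguardsWin (pathGraph 2 □ pathGraph m) 3 := by
  have : Nonempty (Fin 2 × Fin m) := ⟨(0, ⟨0, hm⟩)⟩
  -- Shadows 1 and 2 each stay in one row: there they are the left neighbour (truncated at the
  -- border) if the president is in that row, and his vertical neighbour otherwise.
  let F : ℕ → Fin 2 × Fin m → Fin 2 × Fin m
    | 0, v => (v.1, ⟨min (v.2 + 1) (m - 1), by omega⟩)
    | 1, v => (0, ⟨v.2 + v.1 - 1, by omega⟩)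
    | _, v => (1, ⟨v.2 - v.1, by omega⟩)
  have hF : ∀ i < 3, ∀ u v, Step (pathGraph 2 □ pathGraph m) u v →
      Step (pathGraph 2 □ pathGraph m) (F i u) (F i v) := by
    intro i hi u v h
    rw [grid_step_iff] at h ⊢
    interval_cases i <;> simp only [F, true_and, and_true] <;> omega
  refine bodyguardsWin_of_catchable (k' := 3) le_rfl F hF (fun i hi => ?_) fun v u h => ?_
  · interval_cases i
    · exact catchable_of_two_le (by norm_num) (hF 0 hi)
    · exact catchable_of_fst_eq (by norm_num) (hF 1 hi) fun _ _ => rfl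
    · exact catchable_of_fst_eq (by norm_num) (hF 2 hi) fun _ _ => rfl
  · rw [grid_adj_iff] at h
    have : (v.2.val + 1 = u.2.val ∧ u.1.val = v.1.val) ∨
        (u.1.val = 0 ∧ v.2.val + v.1.val = u.2.val + 1) ∨
        (u.1.val = 1 ∧ v.2.val = u.2.val + v.1.val) := by
      omega
    simp only [Prod.ext_iff, Fin.ext_iff]
    rcases this with h | h | h
    · exact ⟨0, by norm_num, by simp only [F]; omega⟩
    · exact ⟨1, by norm_num, h.1.symm, by simp only [F]; omega⟩
    · exact ⟨2, by norm_num, h.1.symm, by simp only [F]; omega⟩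

theorem bodyguardsWin_square : BodyguardsWin (pathGraph 2 □ pathGraph 2) 2 := by
  -- On the 4-cycle every vertex has exactly one neighbour in each row.
  let F : ℕ → Fin 2 × Fin 2 → Fin 2 × Fin 2
    | 0, v => (0, ⟨(v.1 + v.2 + 1) % 2, by omega⟩)
    | _, v => (1, ⟨(v.1 + v.2) % 2, by omega⟩)
  have hF : ∀ i < 2, ∀ u v, Step (pathGraph 2 □ pathGraph 2) u v →
      Step (pathGraph 2 □ pathGraph 2) (F i u) (F i v) := by
    intro i hi u v h
    rw [grid_step_iff] at h ⊢
    interval_cases i <;> simp only [F, true_and, and_true] <;> omega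
  refine bodyguardsWin_of_catchable (k' := 2) le_rfl F hF (fun i hi => ?_) fun v u h => ?_
  · interval_cases i
    · exact catchable_of_fst_eq (by norm_num) (hF 0 hi) fun _ _ => rfl
    · exact catchable_of_fst_eq (by norm_num) (hF 1 hi) fun _ _ => rfl
  · rw [grid_adj_iff] at h
    simp only [Prod.ext_iff, Fin.ext_iff]
    rcases Nat.lt_or_ge u.1.val 1 with h1 | h1
    · exact ⟨0, by norm_num, by simp only [F]; omega⟩
    · exact ⟨1, by norm_num, by simp only [F]; omega⟩

/-! ### Degree lower bounds and conclusion -/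

theorem four_le_of_bodyguardsWin {k : ℕ} (hn : 3 ≤ n) (hm : 3 ≤ m)
    (h : BodyguardsWin (pathGraph n □ pathGraph m) k) : 4 ≤ k := by
  obtain ⟨S, hS, hadj⟩ := exists_four_neighbors (n := n) (m := m)
    (⟨1, by omega⟩, ⟨1, by omega⟩) (by simp) (by dsimp only; omega) (by simp)
    (by dsimp only; omega)
  exact hS.symm.trans_le (card_le_of_bodyguardsWin h _ S hadj)

theorem three_le_of_bodyguardsWin {k : ℕ} (hm : 3 ≤ m)
    (h : BodyguardsWin (pathGraph 2 □ pathGraph m) k) : 3 ≤ k := by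
  have := card_le_of_bodyguardsWin h (0, ⟨1, by omega⟩)
    {(0, ⟨0, by omega⟩), (0, ⟨2, by omega⟩), (1, ⟨1, by omega⟩)} fun u hu => by
      simp only [Finset.mem_insert, Finset.mem_singleton] at hu
      rw [grid_adj_iff]
      rcases hu with rfl | rfl | rfl <;> simp
  rwa [Finset.card_insert_of_notMem (by simp), Finset.card_pair (by simp)] at this

theorem two_le_of_bodyguardsWin {k : ℕ}
    (h : BodyguardsWin (pathGraph 2 □ pathGraph 2) k) : 2 ≤ k := by
  have := card_le_of_bodyguardsWin h (0, 0) {(0, 1), (1, 0)} fun u hu => by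
    simp only [Finset.mem_insert, Finset.mem_singleton] at hu
    rw [grid_adj_iff]
    rcases hu with rfl | rfl <;> simp
  rwa [Finset.card_pair (by simp)] at this

theorem bodyguardNumber_eq {V : Type*} [Finite V] {G : SimpleGraph V} {k : ℕ}
    (h : BodyguardsWin G k) (hle : ∀ l, BodyguardsWin G l → k ≤ l) : bodyguardNumber G = k :=
  le_antisymm (Nat.sInf_le h) (le_csInf ⟨k, h⟩ hle)

end Grid

end BodyguardGame

open SimpleGraph BodyguardGame in
theorem mainTheorem4 (n m : ℕ) (hnm : n ≤ m) :
    (n = 2 → m = 2 → bodyguardNumber (pathGraph n □ pathGraph m) = 2) ∧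
    (n = 2 → 3 ≤ m → bodyguardNumber (pathGraph n □ pathGraph m) = 3) ∧
    (n = 3 → 3 ≤ m → bodyguardNumber (pathGraph n □ pathGraph m) = 4) ∧
    (4 ≤ n → 4 ≤ m → bodyguardNumber (pathGraph n □ pathGraph m) = 5) := by
  refine ⟨?_, ?_, ?_, fun hn hm => ?_⟩
  · rintro rfl rfl
    exact bodyguardNumber_eq bodyguardsWin_square fun _ => two_le_of_bodyguardsWin
  · rintro rfl hm
    exact bodyguardNumber_eq (bodyguardsWin_two_rows (by omega))
      fun _ => three_le_of_bodyguardsWin hm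
  · rintro rfl hm
    exact bodyguardNumber_eq (bodyguardsWin_three_rows (by omega))
      fun _ => four_le_of_bodyguardsWin le_rfl hm
  · refine bodyguardNumber_eq (bodyguardsWin_five (by omega) (by omega)) fun l hl => ?_
    have h4 : 4 ≤ l := four_le_of_bodyguardsWin (by omega) (by omega) hl
    refine h4.lt_of_ne ?_
    rintro rfl
    exact not_bodyguardsWin_four hn hm hl
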